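/- For a finite Borel measure $\mu$ on $\mathbb{C}$ with compact and infinite support, let $\Phi_n(\cdot;\mu)$ ($n\ge 0$) be its monic orthogonal polynomials, i.e. $\Phi_n(\cdot;\mu)$ is the monic polynomial of degree $n$ that is orthogonal in $L^2(\mu)$ to all polynomials of degree less than $n$, and let $\|\mathcal{M}_\mu\|$ be the operator norm of $\mathcal{M}_\mu:L^2(\mu)\to L^2(\mu)$, $(\mathcal{M}_\mu g)(z)=z\,g(z)$. (1) Let $\mu$ be a finite Borel measure whose support is an infinite compact subset of $\mathbb{R}$, let $\mathcal{N}\subseteq\{1,2,3,\dots\}$ be infinite, and let $f$ be a function such that $$\lim_{n\to\infty,\ n\in\mathcal{N}}\frac{\Phi_{n-1}(z;\mu)}{\Phi_n(z;\mu)}=f(z)\qquad\text{for all } z\in\mathbb{C} \text{ with } |z|>\|\mathcal{M}_\mu\|.$$ Then there is a compactly supported probability measure $\nu$ on $\mathbb{R}$ such that $$f(z)=\int_{\mathbb{R}}\frac{1}{z-w}\,d\nu(w)\qquad\text{for all } z\in\mathbb{C} \text{ with } |z|>\|\mathcal{M}_\mu\|,$$ the integrals being absolutely convergent. (2) Conversely,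 for every compactly supported probability measure $\nu$ on $\mathbb{R}$ there are a probability measure $\mu$ whose support is an infinite compact subset of $\mathbb{R}$ and an infinite set $\mathcal{N}\subseteq\{1,2,3,\dots\}$ such that $$\lim_{n\to\infty,\ n\in\mathcal{N}}\frac{\Phi_{n-1}(z;\mu)}{\Phi_n(z;\mu)}=\int_{\mathbb{R}}\frac{1}{z-w}\,d\nu(w)\qquad\text{for all } z\in\mathbb{C} \text{ with } |z|>\|\mathcal{M}_\mu\|,$$ the integrals being absolutely convergent. -/

import Mathlib

open MeasureTheory Filter Topology Polynomial
open scoped ENNReal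

noncomputable section

namespace RatioAsymptotics

/-- The `L²(μ)` pairing `∫ conj (P z) * Q z dμ(z)` of two polynomials
(conjugate-linear in the first argument). -/
def polyInner (μ : Measure ℂ) (P Q : ℂ[X]) : ℂ :=
  ∫ z, (starRingEnd ℂ) (P.eval z) * Q.eval z ∂μ

/-- The monic orthogonal polynomials `Φ_n(·; μ)`, obtained by the (unnormalized) Gram-Schmidt
process applied to `1, z, z², …` in `L²(μ)`:
`Φ_n = zⁿ - ∑_{k < n} (⟨Φ_k, zⁿ⟩ / ⟨Φ_k, Φ_k⟩) Φ_k`. -/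
def monicOP (μ : Measure ℂ) (n : ℕ) : ℂ[X] :=
  X ^ n - ∑ k : Fin n,
    C (polyInner μ (monicOP μ k) (X ^ n) / polyInner μ (monicOP μ k) (monicOP μ k)) *
      monicOP μ k
termination_by n
decreasing_by exact k.isLt

/-- The coordinate function is essentially bounded for a measure with compact support. -/
theorem memLp_top_id {μ : Measure ℂ} (hμ : IsCompact μ.support) :
    MemLp (fun z : ℂ => z) ∞ μ := by
  obtain ⟨R, hR⟩ := hμ.isBounded.exists_norm_le
  refine memLp_top_of_bound aestronglyMeasurable_id R ?_
  filter_upwards [Measure.support_mem_ae (μ := μ)] with z hz using hR z hz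

/-- The operator `ℳ : L²(μ) → L²(μ)`, `(ℳ f)(z) = z f(z)`, for a measure `μ` on `ℂ` with
compact support, as a bounded operator. Its norm `‖ℳ‖` is the operator norm. -/
def mulZ (μ : Measure ℂ) (hμ : IsCompact μ.support) : Lp ℂ 2 μ →L[ℂ] Lp ℂ 2 μ :=
  (ContinuousLinearMap.mul ℂ ℂ).holderL μ ∞ 2 2 ((memLp_top_id hμ).toLp (fun z : ℂ => z))

/-- `𝒩 ⊆ {1, 2, 3, …}` is an infinite set of indices along which
`Φ_{n-1}(z; μ) / Φ_n(z; μ) → f z` for every `z` with `|z| > ‖ℳ‖`. -/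
structure IsRatioLimitAlong (μ : Measure ℂ) (hμ : IsCompact μ.support) (N : Set ℕ)
    (f : ℂ → ℂ) : Prop where
  one_le : ∀ n ∈ N, 1 ≤ n
  infinite : N.Infinite
  tendsto : ∀ z : ℂ, ‖mulZ μ hμ‖ < ‖z‖ →
    Tendsto (fun n : ℕ => (monicOP μ (n - 1)).eval z / (monicOP μ n).eval z)
      (atTop ⊓ 𝓟 N) (𝓝 (f z))

/-- `f` is the Stieltjes transform `f z = ∫ 1 / (z - w) dν(w)` of `ν` on `{z : |z| > r}`
(the integrals being required to converge absolutely). -/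
def IsStieltjesOutside (ν : Measure ℝ) (r : ℝ) (f : ℂ → ℂ) : Prop :=
  ∀ z : ℂ, r < ‖z‖ →
    Integrable (fun w : ℝ => 1 / (z - (w : ℂ))) ν ∧ f z = ∫ w : ℝ, 1 / (z - (w : ℂ)) ∂ν

end RatioAsymptotics

end

/-! For `|z| > ‖ℳ‖` the ratio `Φ_n(z) / Φ_{n+1}(z)` is the matrix element `⟨φ_n, (z - T_n)⁻¹ φ_n⟩`,
where `T_n` is the compression of `ℳ` to the polynomials of degree at most `n` and
`φ_n = Φ_n / ‖Φ_n‖`. If `μ` lives on the real line, `T_n` is symmetric, so the ratio is the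
Stieltjes transform of a probability measure on `[-‖ℳ‖, ‖ℳ‖]`, and weak compactness of these
measures gives the first part.

Conversely, iterated Schur complements expand the Stieltjes transform of `ν` in a continued fraction
`1 / (z - β₀ - α₀² / (z - β₁ - α₁² / ⋯))`. The ratios `s_n = Φ_n / Φ_{n+1}` satisfy
`s_n = 1 / (z - b_n - a_n² s_{n-1})`, which builds such a fraction from the inside out. Let the
Jacobi coefficients of `μ` consist of longer and longer initial segments of `(β, α)` in reversed
order, with vanishing coupling between consecutive segments: at the ends of the segments the ratios
approach the continued fraction, since each step is a contraction for large `|z|`. A large value of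
`b_0` makes `‖ℳ‖` so large that only such `z` occur. -/

noncomputable section

namespace RatioAsymptotics

theorem norm_le_norm_of_hasEigenvalue {𝕜 E : Type*} [NontriviallyNormedField 𝕜]
    [NormedAddCommGroup E] [NormedSpace 𝕜 E] {A : E →L[𝕜] E} {c : 𝕜}
    (hc : Module.End.HasEigenvalue A.toLinearMap c) : ‖c‖ ≤ ‖A‖ := by
  obtain ⟨v, hv⟩ := hc.exists_hasEigenvector
  refine le_of_mul_le_mul_right ?_ (norm_pos_iff.2 hv.2)
  calc ‖c‖ * ‖v‖ = ‖A v‖ := by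
        rw [← ContinuousLinearMap.coe_coe, hv.apply_eq_smul, norm_smul]
    _ ≤ ‖A‖ * ‖v‖ := A.le_opNorm v

section Resolvent

variable {𝕜 E : Type*} [NontriviallyNormedField 𝕜] [NormedAddCommGroup E] [NormedSpace 𝕜 E]
  [CompleteSpace E]

theorem resolvent_apply_eq_iff {A : E →L[𝕜] E} {z : 𝕜} (hz : ‖A‖ < ‖z‖) {x y : E} :
    resolvent A z x = y ↔ z • y - A y = x := by
  have hunit : IsUnit (algebraMap 𝕜 (E →L[𝕜] E) z - A) :=
    spectrum.mem_resolventSet_of_norm_lt_mul <|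
      (mul_le_of_le_one_right (norm_nonneg A) ContinuousLinearMap.norm_id_le).trans_lt hz
  have happly (v : E) : z • v - A v = (algebraMap 𝕜 (E →L[𝕜] E) z - A) v := rfl
  rw [happly, resolvent]
  constructor
  · rintro rfl
    exact DFunLike.congr_fun (Ring.mul_inverse_cancel _ hunit) x
  · rintro rfl
    exact DFunLike.congr_fun (Ring.inverse_mul_cancel _ hunit) y

theorem norm_resolvent_apply_le {A : E →L[𝕜] E} {R : ℝ} (hA : ‖A‖ ≤ R) {z : 𝕜} (hz : R < ‖z‖)
    (x : E) : ‖resolvent A z x‖ ≤ ‖x‖ / (‖z‖ - R) := by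
  set y := resolvent A z x
  have hy : z • y - A y = x := (resolvent_apply_eq_iff (hA.trans_lt hz)).1 rfl
  rw [le_div_iff₀ (sub_pos.2 hz)]
  calc ‖y‖ * (‖z‖ - R) = ‖z • y‖ - R * ‖y‖ := by rw [norm_smul]; ring
    _ ≤ ‖z • y‖ - ‖A y‖ := by gcongr; exact A.le_of_opNorm_le hA y
    _ ≤ ‖x‖ := hy ▸ norm_sub_norm_le _ _

end Resolvent

section ResolventFunction

variable {H : Type*} [NormedAddCommGroup H] [InnerProductSpace ℂ H]

/-- The diagonal matrix element `⟨e, (z - A)⁻¹ e⟩` of the resolvent of `A`. It is `0` at points of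
the spectrum, and is only used for `‖A‖ < ‖z‖`. -/
def resolventFunction (A : H →L[ℂ] H) (e : H) (z : ℂ) : ℂ :=
  inner ℂ e (resolvent A z e)

theorem resolventFunction_smul (A : H →L[ℂ] H) (c : ℂ) (e : H) (z : ℂ) :
    resolventFunction A (c • e) z = (‖c‖ : ℂ) ^ 2 * resolventFunction A e z := by
  rw [resolventFunction, map_smul, inner_smul_left, inner_smul_right, ← mul_assoc,
    Complex.conj_mul', resolventFunction]

theorem norm_resolventFunction_le [CompleteSpace H] {A : H →L[ℂ] H} {R : ℝ} (hA : ‖A‖ ≤ R)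
    {e : H} (he : ‖e‖ = 1) {z : ℂ} (hz : R < ‖z‖) :
    ‖resolventFunction A e z‖ ≤ 1 / (‖z‖ - R) := by
  calc ‖resolventFunction A e z‖ ≤ ‖e‖ * ‖resolvent A z e‖ := norm_inner_le_norm _ _
    _ ≤ 1 / (‖z‖ - R) := by simpa [he] using norm_resolvent_apply_le hA hz e

end ResolventFunction

section Compression

variable {H : Type*} [NormedAddCommGroup H] [InnerProductSpace ℂ H]

/-- The compression `P_K A|_K` of an operator `A` to a subspace `K`. -/
def compression (K : Submodule ℂ H) [K.HasOrthogonalProjection] (A : H →L[ℂ] H) : K →L[ℂ] K :=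
  K.orthogonalProjectionOnto ∘L A ∘L K.subtypeL

variable {K : Submodule ℂ H} [K.HasOrthogonalProjection] {A : H →L[ℂ] H}

theorem norm_compression_le : ‖compression K A‖ ≤ ‖A‖ := by
  refine ContinuousLinearMap.opNorm_le_bound _ (norm_nonneg A) fun x => ?_
  exact (K.norm_orthogonalProjectionOnto_apply_le _).trans (A.le_opNorm x)

theorem inner_compression_right (x y : K) :
    inner ℂ x (compression K A y) = inner ℂ (x : H) (A y) :=
  K.inner_orthogonalProjectionOnto_eq_of_mem_left x (A y)

theorem isSymmetric_compression (hA : A.toLinearMap.IsSymmetric) :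
    (compression K A).toLinearMap.IsSymmetric := by
  intro x y
  rw [ContinuousLinearMap.coe_coe, inner_compression_right, ← inner_conj_symm,
    inner_compression_right, inner_conj_symm]
  exact hA x y

end Compression

section SpectralMeasure

variable {E : Type*} [NormedAddCommGroup E] [InnerProductSpace ℂ E] [FiniteDimensional ℂ E]
  {T : E →ₗ[ℂ] E}

/-- The spectral measure at the vector `e` of a symmetric operator on a finite-dimensional space:
each eigenvalue carries the squared length of the component of `e` along its eigenvectors. -/
def spectralMeasure (hT : T.IsSymmetric) (e : E) : Measure ℝ :=
  ∑ i, ENNReal.ofReal (‖inner ℂ (hT.eigenvectorBasis rfl i) e‖ ^ 2) •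
    Measure.dirac (hT.eigenvalues rfl i)

theorem isProbabilityMeasure_spectralMeasure (hT : T.IsSymmetric) {e : E} (he : ‖e‖ = 1) :
    IsProbabilityMeasure (spectralMeasure hT e) where
  measure_univ := by
    simp only [spectralMeasure, Measure.coe_finsetSum, Finset.sum_apply, Measure.smul_apply,
      measure_univ, smul_eq_mul, mul_one]
    rw [← ENNReal.ofReal_sum_of_nonneg (fun i _ => by positivity),
      OrthonormalBasis.sum_sq_norm_inner_right, he, one_pow, ENNReal.ofReal_one]

theorem ae_spectralMeasure_mem (hT : T.IsSymmetric) (e : E) {K : Set ℝ}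
    (hK : ∀ x : ℝ, Module.End.HasEigenvalue T (x : ℂ) → x ∈ K) :
    ∀ᵐ x ∂spectralMeasure hT e, x ∈ K := by
  rw [spectralMeasure, ae_iff, Measure.coe_finsetSum, Finset.sum_apply]
  refine Finset.sum_eq_zero fun i _ => ?_
  rw [Measure.smul_apply, Measure.dirac_apply, Set.indicator_of_notMem, smul_zero]
  exact not_not.2 (hK _ (hT.hasEigenvalue_eigenvalues rfl i))

theorem integral_conj_mul_spectralMeasure (hT : T.IsSymmetric) {e x y : E} {F G : ℝ → ℂ}
    (hx : ∀ i, inner ℂ (hT.eigenvectorBasis rfl i) x =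
      F (hT.eigenvalues rfl i) * inner ℂ (hT.eigenvectorBasis rfl i) e)
    (hy : ∀ i, inner ℂ (hT.eigenvectorBasis rfl i) y =
      G (hT.eigenvalues rfl i) * inner ℂ (hT.eigenvectorBasis rfl i) e) :
    ∫ w, (starRingEnd ℂ) (F w) * G w ∂spectralMeasure hT e = inner ℂ x y := by
  rw [spectralMeasure, integral_finsetSum_measure fun i _ =>
    (integrable_dirac enorm_lt_top).smul_measure ENNReal.ofReal_ne_top,
    ← (hT.eigenvectorBasis rfl).sum_inner_mul_inner x y]
  refine Finset.sum_congr rfl fun i _ => ?_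
  rw [integral_smul_measure, integral_dirac, ENNReal.toReal_ofReal (by positivity),
    Complex.real_smul, Complex.ofReal_pow, ← Complex.conj_mul',
    ← inner_conj_symm x, hx, hy, map_mul]
  ring

theorem inner_eigenvectorBasis_apply (hT : T.IsSymmetric) (x : E) (i : Fin (Module.finrank ℂ E)) :
    inner ℂ (hT.eigenvectorBasis rfl i) (T x) =
      hT.eigenvalues rfl i * inner ℂ (hT.eigenvectorBasis rfl i) x := by
  rw [← OrthonormalBasis.repr_apply_apply, ← OrthonormalBasis.repr_apply_apply]
  exact hT.eigenvectorBasis_apply_self_apply rfl x i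

theorem inner_eigenvectorBasis_aeval (hT : T.IsSymmetric) (x : E) (p : ℂ[X])
    (i : Fin (Module.finrank ℂ E)) :
    inner ℂ (hT.eigenvectorBasis rfl i) (aeval T p x) =
      p.eval (hT.eigenvalues rfl i : ℂ) * inner ℂ (hT.eigenvectorBasis rfl i) x := by
  induction p using Polynomial.induction_on with
  | C a => rw [aeval_C, eval_C, Module.algebraMap_end_apply, inner_smul_right]
  | add p q hp hq => rw [map_add, LinearMap.add_apply, inner_add_right, hp, hq, eval_add, add_mul]
  | monomial k a ih =>
    rw [pow_succ', mul_left_comm, map_mul, aeval_X, Module.End.mul_apply,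
      inner_eigenvectorBasis_apply, ih, ← mul_assoc, eval_mul (p := X), eval_X]

theorem integral_polynomial_spectralMeasure (hT : T.IsSymmetric) (e : E) (p q : ℂ[X]) :
    ∫ w : ℝ, (starRingEnd ℂ) (p.eval (w : ℂ)) * q.eval (w : ℂ) ∂spectralMeasure hT e =
      inner ℂ (aeval T p e) (aeval T q e) :=
  integral_conj_mul_spectralMeasure hT (F := fun w => p.eval (w : ℂ)) (G := fun w => q.eval (w : ℂ))
    (inner_eigenvectorBasis_aeval hT e p) (inner_eigenvectorBasis_aeval hT e q)

theorem integral_inv_sub_spectralMeasure {A : E →L[ℂ] E} (hA : A.toLinearMap.IsSymmetric) (e : E)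
    {z : ℂ} (hz : ‖A‖ < ‖z‖) :
    ∫ w : ℝ, 1 / (z - (w : ℂ)) ∂spectralMeasure hA e = resolventFunction A e z := by
  have hcomponent (i) : inner ℂ (hA.eigenvectorBasis rfl i) (resolvent A z e) =
      1 / (z - (hA.eigenvalues rfl i : ℂ)) * inner ℂ (hA.eigenvectorBasis rfl i) e := by
    have hne : z - (hA.eigenvalues rfl i : ℂ) ≠ 0 := by
      refine sub_ne_zero.2 fun h => hz.not_ge ?_
      rw [h]
      exact norm_le_norm_of_hasEigenvalue (hA.hasEigenvalue_eigenvalues rfl i)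
    have hy := (resolvent_apply_eq_iff hz (x := e)).1 rfl
    nth_rw 2 [← hy]
    rw [inner_sub_right, inner_smul_right, ← ContinuousLinearMap.coe_coe A,
      inner_eigenvectorBasis_apply, ← sub_mul, ← mul_assoc, one_div_mul_cancel hne, one_mul]
  simpa only [map_one, one_mul, resolventFunction] using
    integral_conj_mul_spectralMeasure hA (F := fun _ => 1) (fun _ => (one_mul _).symm) hcomponent

end SpectralMeasure

theorem exists_weakLimit {X ι : Type*} [TopologicalSpace X] [T2Space X] [MeasurableSpace X]
    [BorelSpace X] {K : Set X} (hK : IsCompact K) (ν : ι → Measure X)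
    [∀ i, IsProbabilityMeasure (ν i)] (hν : ∀ i, ∀ᵐ x ∂ν i, x ∈ K) (U : Ultrafilter ι) :
    ∃ σ : Measure X, IsProbabilityMeasure σ ∧ (∀ᵐ x ∂σ, x ∈ K) ∧
      ∀ F : X → ℂ, ContinuousOn F K →
        Integrable F σ ∧ Tendsto (fun i => ∫ x, F x ∂ν i) U (𝓝 (∫ x, F x ∂σ)) := by
  have hemb : MeasurableEmbedding (Subtype.val : K → X) :=
    .subtype_coe hK.measurableSet
  have : CompactSpace K := isCompact_iff_compactSpace.1 hK
  let restricted (i : ι) : ProbabilityMeasure K :=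
    ⟨(ν i).comap Subtype.val, hemb.isProbabilityMeasure_comap (by simpa using hν i)⟩
  obtain ⟨σ, -, hσ⟩ := isCompact_univ.ultrafilter_le_nhds (U.map restricted) (by simp)
  have hlim : Tendsto restricted U (𝓝 σ) := hσ
  rw [ProbabilityMeasure.tendsto_iff_forall_integral_rclike_tendsto ℂ] at hlim
  refine ⟨(σ : Measure K).map Subtype.val,
    Measure.isProbabilityMeasure_map hemb.measurable.aemeasurable, ?_, fun F hF => ?_⟩
  · exact (hemb.ae_map_iff).2 (ae_of_all _ Subtype.prop)
  · let G := BoundedContinuousFunction.mkOfCompact ⟨K.domRestrict F, hF.domRestrict⟩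
    refine ⟨hemb.integrable_map_iff.2 (G.integrable _), ?_⟩
    rw [hemb.integral_map]
    refine (hlim G).congr fun i => ?_
    calc ∫ x, G x ∂(restricted i : Measure K) = ∫ x in K, F x ∂ν i :=
          integral_subtype_comap hK.measurableSet F
      _ = ∫ x, F x ∂ν i := by rw [Measure.restrict_eq_self_of_ae_mem (hν i)]

section PolynomialsInL2

variable {μ : Measure ℂ}

theorem coeFn_mulZ (hμ : IsCompact μ.support) (g : Lp ℂ 2 μ) :
    mulZ μ hμ g =ᵐ[μ] fun z => z * g z := by
  rw [mulZ, ContinuousLinearMap.holderL_apply_apply]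
  filter_upwards [ContinuousLinearMap.coeFn_holder (r := 2) (ContinuousLinearMap.mul ℂ ℂ)
    ((memLp_top_id hμ).toLp (fun z : ℂ => z)) g, MemLp.coeFn_toLp (memLp_top_id hμ)]
    with z hholder hid
  rw [hholder, hid, ContinuousLinearMap.mul_apply']

theorem isSymmetric_mulZ (hμ : IsCompact μ.support)
    (hr : μ.support ⊆ Set.range (fun x : ℝ => (x : ℂ))) :
    (mulZ μ hμ).toLinearMap.IsSymmetric := by
  intro f g
  rw [ContinuousLinearMap.coe_coe, L2.inner_def, L2.inner_def]
  refine integral_congr_ae ?_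
  filter_upwards [coeFn_mulZ hμ f, coeFn_mulZ hμ g, Measure.support_mem_ae (μ := μ)]
    with z hf hg hz
  obtain ⟨x, rfl⟩ := hr hz
  simp only [hf, hg, RCLike.inner_apply, map_mul, Complex.conj_ofReal]
  ring

variable [IsFiniteMeasure μ]

theorem memLp_eval (hμ : IsCompact μ.support) (P : ℂ[X]) (p : ℝ≥0∞) :
    MemLp (fun z => P.eval z) p μ := by
  obtain ⟨C, hC⟩ := hμ.exists_bound_of_continuousOn P.continuous.continuousOn
  refine (memLp_top_of_bound P.continuous.aestronglyMeasurable C ?_).mono_exponent le_top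
  filter_upwards [Measure.support_mem_ae (μ := μ)] with z hz using hC z hz

/-- The class of a polynomial in `L²(μ)`. -/
def polyLp (hμ : IsCompact μ.support) : ℂ[X] →ₗ[ℂ] Lp ℂ 2 μ where
  toFun P := (memLp_eval hμ P 2).toLp _
  map_add' P Q := by
    rw [← MemLp.toLp_add]
    exact MemLp.toLp_congr _ _ (.of_forall fun z => eval_add)
  map_smul' c P := by
    rw [RingHom.id_apply, ← MemLp.toLp_const_smul]
    exact MemLp.toLp_congr _ _ (.of_forall fun _ => eval_smul ..)

theorem coeFn_polyLp (hμ : IsCompact μ.support) (P : ℂ[X]) :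
    polyLp hμ P =ᵐ[μ] fun z => P.eval z :=
  MemLp.coeFn_toLp (memLp_eval hμ P 2)

theorem inner_polyLp (hμ : IsCompact μ.support) (P Q : ℂ[X]) :
    inner ℂ (polyLp hμ P) (polyLp hμ Q) = polyInner μ P Q := by
  rw [L2.inner_def, polyInner]
  refine integral_congr_ae ?_
  filter_upwards [coeFn_polyLp hμ P, coeFn_polyLp hμ Q] with z hP hQ
  rw [hP, hQ, RCLike.inner_apply, mul_comm]

theorem mulZ_polyLp (hμ : IsCompact μ.support) (P : ℂ[X]) :
    mulZ μ hμ (polyLp hμ P) = polyLp hμ (X * P) := by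
  refine Lp.ext ?_
  filter_upwards [coeFn_mulZ hμ (polyLp hμ P), coeFn_polyLp hμ P, coeFn_polyLp hμ (X * P)]
    with z hmul hP hXP
  rw [hmul, hP, hXP, eval_mul, eval_X]

theorem polyLp_eq_zero_iff (hμ : IsCompact μ.support) {P : ℂ[X]} :
    polyLp hμ P = 0 ↔ ∀ᵐ z ∂μ, P.eval z = 0 := by
  rw [Lp.eq_zero_iff_ae_eq_zero]
  exact (coeFn_polyLp hμ P).congr_left

theorem polyLp_injective (hμ : IsCompact μ.support) (hinf : μ.support.Infinite) :
    Function.Injective (polyLp hμ) := by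
  refine (injective_iff_map_eq_zero _).2 fun P hP => ?_
  have hroots : μ.support ⊆ {z | P.eval z = 0} := Measure.support_subset_of_isClosed
    (isClosed_eq P.continuous continuous_const) ((polyLp_eq_zero_iff hμ).1 hP)
  exact P.eq_zero_of_infinite_isRoot (hinf.mono hroots)

end PolynomialsInL2

section OrthogonalPolynomials

theorem map_eq_zero_of_degree_lt {F M : Type*} [Field F] [AddCommGroup M] [Module F M]
    (S : Polynomial.Sequence F) (ℓ : F[X] →ₗ[F] M) {n : ℕ} (h : ∀ k < n, ℓ (S k) = 0) {Q : F[X]}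
    (hQ : Q.degree < n) : ℓ Q = 0 := by
  have hspan : degreeLT F n ≤ LinearMap.ker ℓ := by
    rw [← S.span_degreeLT fun i _ => isUnit_iff_ne_zero.2 (leadingCoeff_ne_zero.2 (S.ne_zero i)),
      Submodule.span_le]
    rintro _ ⟨k, hk, rfl⟩
    exact h k hk
  exact hspan (mem_degreeLT.2 hQ)

theorem degree_sum_C_mul_lt {R : Type*} [Semiring R] {n : ℕ} {P : Fin n → R[X]} (c : Fin n → R)
    (hP : ∀ k, (P k).degree = k) : (∑ k, C (c k) * P k).degree < n := by
  refine mem_degreeLT.1 (Submodule.sum_mem _ fun k _ => mem_degreeLT.2 ?_)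
  rw [← smul_eq_C_mul]
  refine (degree_smul_le _ _).trans_lt ?_
  rw [hP k]
  exact WithBot.coe_lt_coe.2 k.2

theorem degree_monicOP (μ : Measure ℂ) (n : ℕ) : (monicOP μ n).degree = n := by
  induction n using Nat.strong_induction_on with
  | _ n ih =>
    rw [monicOP, degree_sub_eq_left_of_degree_lt, degree_X_pow]
    rw [degree_X_pow]
    exact degree_sum_C_mul_lt _ fun k => ih k k.2

theorem monic_monicOP (μ : Measure ℂ) (n : ℕ) : (monicOP μ n).Monic := by
  rw [monicOP]
  refine (monic_X_pow n).sub_of_left ?_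
  rw [degree_X_pow]
  exact degree_sum_C_mul_lt _ fun k => degree_monicOP μ k

theorem coeff_monicOP_self (μ : Measure ℂ) (n : ℕ) : (monicOP μ n).coeff n = 1 := by
  simpa only [natDegree_eq_of_degree_eq_some (degree_monicOP μ n)] using
    (monic_monicOP μ n).coeff_natDegree

/-- The monic orthogonal polynomials, as a sequence with one member in each degree. -/
def monicOPSequence (μ : Measure ℂ) : Polynomial.Sequence ℂ where
  elems' := monicOP μ
  degree_eq' := degree_monicOP μ

variable {μ : Measure ℂ}

theorem degree_sub_C_mul_monicOP_lt {n : ℕ} {Q : ℂ[X]} (hQ : Q.degree ≤ n) :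
    (Q - C (Q.coeff n) * monicOP μ n).degree < n := by
  refine lt_of_le_of_ne ((degree_sub_le _ _).trans (max_le hQ ?_)) fun h =>
    coeff_ne_zero_of_eq_degree h ?_
  · rw [← smul_eq_C_mul]
    exact (degree_smul_le _ _).trans (degree_monicOP μ n).le
  · rw [coeff_sub, coeff_C_mul, coeff_monicOP_self, mul_one, sub_self]

variable [IsFiniteMeasure μ]

theorem polyLp_monicOP (hμ : IsCompact μ.support) (n : ℕ) :
    polyLp hμ (monicOP μ n) =
      InnerProductSpace.gramSchmidt ℂ (fun k => polyLp hμ (X ^ k)) n := by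
  induction n using Nat.strong_induction_on with
  | _ n ih =>
    rw [monicOP, InnerProductSpace.gramSchmidt_def, map_sub, map_sum, Nat.Iio_eq_range,
      ← Fin.sum_univ_eq_sum_range (fun k => (ℂ ∙ InnerProductSpace.gramSchmidt ℂ _ k).starProjection
        (polyLp hμ (X ^ n)))]
    congr 1
    refine Finset.sum_congr rfl fun k _ => ?_
    rw [← ih k k.2, Submodule.starProjection_singleton, ← smul_eq_C_mul, map_smul,
      ← inner_polyLp hμ, ← inner_polyLp hμ, inner_self_eq_norm_sq_to_K]
    norm_cast

theorem inner_monicOP_of_degree_lt (hμ : IsCompact μ.support) {n : ℕ} {Q : ℂ[X]}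
    (hQ : Q.degree < n) : inner ℂ (polyLp hμ (monicOP μ n)) (polyLp hμ Q) = 0 := by
  refine map_eq_zero_of_degree_lt (monicOPSequence μ)
    (innerₛₗ ℂ (polyLp hμ (monicOP μ n)) ∘ₗ polyLp hμ) (fun k hk => ?_) hQ
  change inner ℂ (polyLp hμ (monicOP μ n)) (polyLp hμ (monicOP μ k)) = 0
  rw [polyLp_monicOP, polyLp_monicOP]
  exact InnerProductSpace.gramSchmidt_orthogonal ℂ _ hk.ne'

theorem inner_monicOP_of_degree_le (hμ : IsCompact μ.support) {n : ℕ} {Q : ℂ[X]}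
    (hQ : Q.degree ≤ n) : inner ℂ (polyLp hμ (monicOP μ n)) (polyLp hμ Q) =
      Q.coeff n * (‖polyLp hμ (monicOP μ n)‖ : ℂ) ^ 2 := by
  have h := inner_monicOP_of_degree_lt hμ (degree_sub_C_mul_monicOP_lt (μ := μ) hQ)
  rwa [map_sub, ← smul_eq_C_mul, map_smul, inner_sub_right, inner_smul_right,
    inner_self_eq_norm_sq_to_K, sub_eq_zero] at h

theorem eq_C_mul_monicOP (hμ : IsCompact μ.support) (hinf : μ.support.Infinite) {n : ℕ} {Q : ℂ[X]}
    (hQ : Q.degree ≤ n)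
    (horth : ∀ P : ℂ[X], P.degree < n → inner ℂ (polyLp hμ P) (polyLp hμ Q) = 0) :
    Q = C (Q.coeff n) * monicOP μ n := by
  have hdeg := degree_sub_C_mul_monicOP_lt (μ := μ) hQ
  refine sub_eq_zero.1 (polyLp_injective hμ hinf ?_)
  rw [map_zero, ← inner_self_eq_zero (𝕜 := ℂ)]
  nth_rw 2 [map_sub]
  rw [inner_sub_right, horth _ hdeg, ← smul_eq_C_mul, map_smul, inner_smul_right, smul_eq_C_mul,
    inner_eq_zero_symm.1 (inner_monicOP_of_degree_lt hμ hdeg), mul_zero, sub_zero]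

end OrthogonalPolynomials

section Truncation

variable {μ : Measure ℂ} [IsFiniteMeasure μ]

/-- The subspace of `L²(μ)` spanned by the polynomials of degree at most `n`. -/
def polySubspace (hμ : IsCompact μ.support) (n : ℕ) : Submodule ℂ (Lp ℂ 2 μ) :=
  (degreeLE ℂ n).map (polyLp hμ)

instance (hμ : IsCompact μ.support) (n : ℕ) : FiniteDimensional ℂ (polySubspace hμ n) := by
  have : FiniteDimensional ℂ (degreeLE ℂ n) := by
    rw [← degreeLT_succ_eq_degreeLE]
    exact (degreeLTEquiv ℂ (n + 1)).symm.finiteDimensional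
  unfold polySubspace
  infer_instance

/-- The compression of multiplication by `z` to the polynomials of degree at most `n`; in the
orthonormal basis of orthogonal polynomials its matrix is the truncated Jacobi (or, off the real
line, Hessenberg) matrix. -/
def truncation (hμ : IsCompact μ.support) (n : ℕ) : polySubspace hμ n →L[ℂ] polySubspace hμ n :=
  compression (polySubspace hμ n) (mulZ μ hμ)

theorem norm_truncation_le (hμ : IsCompact μ.support) (n : ℕ) :
    ‖truncation hμ n‖ ≤ ‖mulZ μ hμ‖ :=
  norm_compression_le

theorem inner_truncation_right (hμ : IsCompact μ.support) {n : ℕ} (x y : polySubspace hμ n) :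
    inner ℂ x (truncation hμ n y) = inner ℂ (x : Lp ℂ 2 μ) (mulZ μ hμ y) :=
  inner_compression_right x y

theorem isSymmetric_truncation (hμ : IsCompact μ.support)
    (hr : μ.support ⊆ Set.range (fun x : ℝ => (x : ℂ))) (n : ℕ) :
    (truncation hμ n).toLinearMap.IsSymmetric :=
  isSymmetric_compression (isSymmetric_mulZ hμ hr)

/-- The class of `Φ_n` in the space of polynomials of degree at most `n`. -/
def monicOPVector (hμ : IsCompact μ.support) (n : ℕ) : polySubspace hμ n :=
  ⟨polyLp hμ (monicOP μ n), Submodule.mem_map_of_mem (mem_degreeLE.2 (degree_monicOP μ n).le)⟩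

/-- The class of the orthonormal polynomial `Φ_n / ‖Φ_n‖`. -/
def orthonormalVector (hμ : IsCompact μ.support) (n : ℕ) : polySubspace hμ n :=
  (‖monicOPVector hμ n‖ : ℂ)⁻¹ • monicOPVector hμ n

variable (hμ : IsCompact μ.support) (hinf : μ.support.Infinite) {z : ℂ} (hz : ‖mulZ μ hμ‖ < ‖z‖)
include hinf

theorem monicOPVector_ne_zero (n : ℕ) : monicOPVector hμ n ≠ 0 := fun h =>
  (monic_monicOP μ n).ne_zero <| polyLp_injective hμ hinf <| by
    rw [map_zero]
    exact congrArg Subtype.val h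

theorem norm_orthonormalVector (n : ℕ) : ‖orthonormalVector hμ n‖ = 1 :=
  norm_smul_inv_norm (monicOPVector_ne_zero hμ hinf n)

include hz

-- The resolvent equation says that `Φ_n - (z - w) q(w)`, of degree at most `n + 1`, is orthogonal
-- to all polynomials of degree at most `n`, hence is a multiple of `Φ_{n+1}`.
theorem exists_resolvent_truncation_eq_polyLp (n : ℕ) :
    ∃ q : ℂ[X], q.degree ≤ n ∧
      (resolvent (truncation hμ n) z (monicOPVector hμ n) : Lp ℂ 2 μ) = polyLp hμ q ∧
      monicOP μ n = (C z - X) * q + C (q.coeff n) * monicOP μ (n + 1) := by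
  set y := resolvent (truncation hμ n) z (monicOPVector hμ n) with hy
  obtain ⟨q, hq, hyq⟩ := y.2
  rw [SetLike.mem_coe, mem_degreeLE] at hq
  refine ⟨q, hq, hyq.symm, ?_⟩
  set D := monicOP μ n - (C z - X) * q with hD
  have hDdeg : D.degree ≤ (n + 1 : ℕ) := by
    have hfactor : (C z - X : ℂ[X]).degree ≤ 1 :=
      (degree_sub_le _ _).trans (max_le (degree_C_le.trans zero_le_one) degree_X_le)
    refine (degree_sub_le _ _).trans (max_le ?_ ((degree_mul_le _ _).trans ?_))
    · rw [degree_monicOP]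
      exact_mod_cast n.le_succ
    · rw [add_comm, Nat.cast_succ]
      exact add_le_add hq hfactor
  have hDcoeff : D.coeff (n + 1) = q.coeff n := by
    have hlt : (n : WithBot ℕ) < (n + 1 : ℕ) := WithBot.coe_lt_coe.2 n.lt_succ_self
    rw [coeff_sub, sub_mul, coeff_sub, coeff_C_mul, coeff_X_mul,
      coeff_eq_zero_of_degree_lt ((degree_monicOP μ n).trans_lt hlt),
      coeff_eq_zero_of_degree_lt (hq.trans_lt hlt), mul_zero, zero_sub, zero_sub, neg_neg]
  have horth (P : ℂ[X]) (hP : P.degree < (n + 1 : ℕ)) :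
      inner ℂ (polyLp hμ P) (polyLp hμ D) = 0 := by
    rw [← mem_degreeLT, degreeLT_succ_eq_degreeLE] at hP
    have hsolve := congrArg
      (inner ℂ (⟨polyLp hμ P, Submodule.mem_map_of_mem hP⟩ : polySubspace hμ n))
      ((resolvent_apply_eq_iff ((norm_truncation_le hμ n).trans_lt hz)).1 hy.symm)
    rw [inner_sub_right, inner_truncation_right, inner_smul_right, Submodule.coe_inner,
      Submodule.coe_inner, ← hyq, mulZ_polyLp, ← inner_smul_right, ← inner_sub_right, ← map_smul,
      ← map_sub, monicOPVector] at hsolve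
    rw [hD, map_sub, inner_sub_right, ← hsolve, smul_eq_C_mul, ← sub_mul, sub_self]
  rw [← hDcoeff, ← eq_C_mul_monicOP hμ hinf hDdeg horth, hD, add_sub_cancel]

theorem eval_monicOP_ne_zero (n : ℕ) : (monicOP μ n).eval z ≠ 0 := by
  induction n with
  | zero =>
    rw [(monic_monicOP μ 0).degree_le_zero_iff_eq_one.1 (degree_monicOP μ 0).le, eval_one]
    exact one_ne_zero
  | succ n ih =>
    obtain ⟨q, -, -, hq⟩ := exists_resolvent_truncation_eq_polyLp hμ hinf hz n
    intro hzero
    apply ih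
    rw [hq]
    simp [hzero]

theorem monicOP_ratio_eq_resolventFunction (n : ℕ) :
    (monicOP μ n).eval z / (monicOP μ (n + 1)).eval z =
      resolventFunction (truncation hμ n) (orthonormalVector hμ n) z := by
  obtain ⟨q, hqdeg, hqy, hq⟩ := exists_resolvent_truncation_eq_polyLp hμ hinf hz n
  have hratio : (monicOP μ n).eval z / (monicOP μ (n + 1)).eval z = q.coeff n := by
    rw [div_eq_iff (eval_monicOP_ne_zero hμ hinf hz (n + 1)), hq]
    simp
  have hne : (‖monicOPVector hμ n‖ : ℂ) ≠ 0 := by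
    exact_mod_cast norm_ne_zero_iff.2 (monicOPVector_ne_zero hμ hinf n)
  have hinner : resolventFunction (truncation hμ n) (monicOPVector hμ n) z =
      q.coeff n * (‖monicOPVector hμ n‖ : ℂ) ^ 2 := by
    rw [resolventFunction, Submodule.coe_inner, hqy]
    exact inner_monicOP_of_degree_le hμ hqdeg
  rw [hratio, orthonormalVector, resolventFunction_smul, hinner, norm_inv, Complex.norm_real,
    norm_norm, Complex.ofReal_inv]
  field_simp

theorem norm_monicOP_ratio_le (n : ℕ) :
    ‖(monicOP μ n).eval z / (monicOP μ (n + 1)).eval z‖ ≤ 1 / (‖z‖ - ‖mulZ μ hμ‖) := by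
  rw [monicOP_ratio_eq_resolventFunction hμ hinf hz]
  exact norm_resolventFunction_le (norm_truncation_le hμ n) (norm_orthonormalVector hμ hinf n) hz

end Truncation

theorem continuousOn_one_div_sub {R : ℝ} {z : ℂ} (hz : R < ‖z‖) :
    ContinuousOn (fun w : ℝ => 1 / (z - (w : ℂ))) (Metric.closedBall 0 R) := by
  refine continuousOn_const.div (by fun_prop) fun w hw => sub_ne_zero.2 fun h => hz.not_ge ?_
  rw [h, Complex.norm_real]
  exact mem_closedBall_zero_iff.1 hw

theorem isCompact_support_of_ae_mem {X : Type*} [TopologicalSpace X] [T2Space X]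
    [MeasurableSpace X] {σ : Measure X} {K : Set X} (hK : IsCompact K) (hσ : ∀ᵐ x ∂σ, x ∈ K) :
    IsCompact σ.support :=
  hK.of_isClosed_subset Measure.isClosed_support
    (Measure.support_subset_of_isClosed hK.isClosed hσ)

theorem exists_isStieltjesOutside_of_isRatioLimitAlong {μ : Measure ℂ} [IsFiniteMeasure μ]
    (hμ : IsCompact μ.support) (hinf : μ.support.Infinite)
    (hr : μ.support ⊆ Set.range (fun x : ℝ => (x : ℂ))) {N : Set ℕ} {f : ℂ → ℂ}
    (hf : IsRatioLimitAlong μ hμ N f) :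
    ∃ ν : Measure ℝ, IsProbabilityMeasure ν ∧ IsCompact ν.support ∧
      IsStieltjesOutside ν ‖mulZ μ hμ‖ f := by
  have : (atTop ⊓ 𝓟 N).NeBot :=
    frequently_mem_iff_neBot.1 (Nat.frequently_atTop_iff_infinite.2 hf.infinite)
  let U := Ultrafilter.of (atTop ⊓ 𝓟 N)
  have hU : (U : Filter ℕ) ≤ atTop ⊓ 𝓟 N := Ultrafilter.of_le _
  let ν (n : ℕ) : Measure ℝ :=
    spectralMeasure (isSymmetric_truncation hμ hr (n - 1)) (orthonormalVector hμ (n - 1))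
  have (n : ℕ) : IsProbabilityMeasure (ν n) :=
    isProbabilityMeasure_spectralMeasure _ (norm_orthonormalVector hμ hinf (n - 1))
  have hν (n : ℕ) : ∀ᵐ x ∂ν n, x ∈ Metric.closedBall (0 : ℝ) ‖mulZ μ hμ‖ :=
    ae_spectralMeasure_mem _ _ fun x hx => mem_closedBall_zero_iff.2 <| by
      simpa using (norm_le_norm_of_hasEigenvalue hx).trans (norm_truncation_le hμ _)
  obtain ⟨σ, hprob, hσ, hlim⟩ := exists_weakLimit (isCompact_closedBall _ _) ν hν U
  refine ⟨σ, hprob, isCompact_support_of_ae_mem (isCompact_closedBall _ _) hσ, fun z hz => ?_⟩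
  obtain ⟨hint, htendsto⟩ := hlim _ (continuousOn_one_div_sub hz)
  refine ⟨hint, tendsto_nhds_unique ((hf.tendsto z hz).mono_left hU) (htendsto.congr' ?_)⟩
  filter_upwards [hU (mem_inf_of_right (mem_principal_self N))] with n hn
  rw [integral_inv_sub_spectralMeasure _ _ ((norm_truncation_le hμ _).trans_lt hz),
    ← monicOP_ratio_eq_resolventFunction hμ hinf hz, Nat.sub_add_cancel (hf.one_le n hn)]

section RealMeasures

variable {σ : Measure ℝ}

theorem measurableEmbedding_ofReal : MeasurableEmbedding ((↑) : ℝ → ℂ) :=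
  Complex.isometry_ofReal.isClosedEmbedding.measurableEmbedding

theorem polyInner_map_ofReal (σ : Measure ℝ) (P Q : ℂ[X]) :
    polyInner (σ.map ((↑) : ℝ → ℂ)) P Q =
      ∫ x : ℝ, (starRingEnd ℂ) (P.eval (x : ℂ)) * Q.eval (x : ℂ) ∂σ :=
  measurableEmbedding_ofReal.integral_map _

theorem support_map_ofReal_subset (σ : Measure ℝ) :
    (σ.map ((↑) : ℝ → ℂ)).support ⊆ Set.range (fun x : ℝ => (x : ℂ)) :=
  Measure.support_subset_of_isClosed Complex.isometry_ofReal.isClosedEmbedding.isClosed_range <|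
    measurableEmbedding_ofReal.ae_map_iff.2 (.of_forall Set.mem_range_self)

theorem isCompact_support_map_ofReal {K : Set ℝ} (hK : IsCompact K) (hσ : ∀ᵐ x ∂σ, x ∈ K) :
    IsCompact (σ.map ((↑) : ℝ → ℂ)).support :=
  isCompact_support_of_ae_mem (hK.image Complex.continuous_ofReal) <|
    measurableEmbedding_ofReal.ae_map_iff.2 (hσ.mono fun _ => Set.mem_image_of_mem _)

end RealMeasures

section OrthogonalSequences

variable {μ : Measure ℂ} [IsFiniteMeasure μ] (hμ : IsCompact μ.support)

theorem support_infinite_of_polyLp_injective (hinj : Function.Injective (polyLp hμ)) :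
    μ.support.Infinite := by
  intro hfin
  set Q : ℂ[X] := ∏ x ∈ hfin.toFinset, (X - C x) with hQ
  have hQ0 : polyLp hμ Q = 0 := by
    refine (polyLp_eq_zero_iff hμ).2 ?_
    filter_upwards [Measure.support_mem_ae (μ := μ)] with z hz
    rw [hQ, eval_prod]
    exact Finset.prod_eq_zero (hfin.mem_toFinset.2 hz) (by rw [eval_sub, eval_X, eval_C, sub_self])
  exact (monic_prod_X_sub_C id _).ne_zero (hinj (hQ0.trans (map_zero _).symm))

variable (S : Polynomial.Sequence ℂ)
  (horth : Pairwise fun j k => inner ℂ (polyLp hμ (S j)) (polyLp hμ (S k)) = 0)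
include horth

theorem polyLp_injective_of_pairwise_orthogonal (hne : ∀ n, polyLp hμ (S n) ≠ 0) :
    Function.Injective (polyLp hμ) :=
  LinearMap.injective_of_linearIndependent
    (S.span fun n => isUnit_iff_ne_zero.2 (leadingCoeff_ne_zero.2 (S.ne_zero n)))
    (linearIndependent_of_ne_zero_of_inner_eq_zero hne horth)

theorem monicOP_eq_of_pairwise_orthogonal (hinf : μ.support.Infinite)
    (hmonic : ∀ n, (S n).Monic) (n : ℕ) : monicOP μ n = S n := by
  have hcoeff : (S n).coeff n = 1 := by
    simpa only [S.natDegree_eq] using (hmonic n).coeff_natDegree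
  have hlow (P : ℂ[X]) (hP : P.degree < n) : inner ℂ (polyLp hμ P) (polyLp hμ (S n)) = 0 :=
    inner_eq_zero_symm.1 <| map_eq_zero_of_degree_lt S
      (innerₛₗ ℂ (polyLp hμ (S n)) ∘ₗ polyLp hμ) (fun k hk => horth hk.ne') hP
  have h := eq_C_mul_monicOP hμ hinf (S.degree_eq n).le hlow
  rw [hcoeff, C_1, one_mul] at h
  exact h.symm

end OrthogonalSequences

section JacobiMatrices

theorem exists_norm_le_sum_norm_of_hasEigenvalue {𝕜 n : Type*} [NormedField 𝕜] [Fintype n]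
    [DecidableEq n] {M : Matrix n n 𝕜} {c : 𝕜}
    (hc : Module.End.HasEigenvalue (Matrix.toLin' M) c) : ∃ k, ‖c‖ ≤ ∑ j, ‖M k j‖ := by
  obtain ⟨k, hk⟩ := eigenvalue_mem_ball hc
  refine ⟨k, ?_⟩
  rw [← Finset.add_sum_erase _ _ (Finset.mem_univ k), ← sub_le_iff_le_add']
  exact (norm_sub_norm_le _ _).trans (mem_closedBall_iff_norm.1 hk)

theorem sum_ite_const_le {ι : Type*} [Fintype ι] {p : ι → Prop} [DecidablePred p]
    (hp : ∀ i j, p i → p j → i = j) {A : ℝ} (hA : 0 ≤ A) : ∑ j, (if p j then A else 0) ≤ A := by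
  rw [← Finset.sum_filter, Finset.sum_const]
  have hcard : (Finset.univ.filter p).card ≤ 1 := Finset.card_le_one.2 fun i hi j hj =>
    hp i j (Finset.mem_filter.1 hi).2 (Finset.mem_filter.1 hj).2
  simpa only [one_nsmul] using nsmul_le_nsmul_left hA hcard

/-- The truncated Jacobi matrix: `b i` on the diagonal, and `a (i + 1)` linking the indices `i` and
`i + 1`. -/
def jacobiMatrix (b a : ℕ → ℝ) (N : ℕ) : Matrix (Fin N) (Fin N) ℂ := fun i j =>
  if (i : ℕ) = j then (b i : ℂ)
  else if (i : ℕ) = j + 1 then (a i : ℂ)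
  else if (j : ℕ) = i + 1 then (a j : ℂ)
  else 0

/-- The standard basis vector with index `k`, or `0` if `N ≤ k`. -/
def stdVec (N k : ℕ) : EuclideanSpace ℂ (Fin N) :=
  WithLp.toLp 2 fun i => if (i : ℕ) = k then 1 else 0

theorem stdVec_of_lt {N k : ℕ} (hk : k < N) : stdVec N k = EuclideanSpace.single ⟨k, hk⟩ 1 := by
  ext i
  simp only [stdVec, PiLp.single_apply, Fin.ext_iff]

theorem inner_stdVec {N j k : ℕ} (hj : j < N) :
    inner ℂ (stdVec N j) (stdVec N k) = if j = k then 1 else 0 := by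
  rw [stdVec_of_lt hj, EuclideanSpace.inner_single_left, map_one, one_mul]
  rfl

theorem toEuclideanLin_stdVec_apply {N k : ℕ} (M : Matrix (Fin N) (Fin N) ℂ) (hk : k < N)
    (i : Fin N) : Matrix.toEuclideanLin M (stdVec N k) i = M i ⟨k, hk⟩ := by
  rw [stdVec_of_lt hk, Matrix.toLpLin_apply, PiLp.ofLp_single, Matrix.mulVec_single_one]
  rfl

variable (b a : ℕ → ℝ)

theorem isHermitian_jacobiMatrix (N : ℕ) : (jacobiMatrix b a N).IsHermitian := by
  ext i j
  simp only [Matrix.conjTranspose_apply, jacobiMatrix]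
  split_ifs <;> first | omega | simp_all

theorem jacobiMatrix_stdVec_zero {N : ℕ} (hN : 0 < N) :
    Matrix.toEuclideanLin (jacobiMatrix b a N) (stdVec N 0) =
      (b 0 : ℂ) • stdVec N 0 + (a 1 : ℂ) • stdVec N 1 := by
  ext i
  rw [toEuclideanLin_stdVec_apply _ hN]
  simp only [jacobiMatrix, stdVec, PiLp.add_apply, PiLp.smul_apply, smul_eq_mul]
  split_ifs <;> first | omega | simp_all

theorem jacobiMatrix_stdVec_succ {N k : ℕ} (hk : k + 1 < N) :
    Matrix.toEuclideanLin (jacobiMatrix b a N) (stdVec N (k + 1)) =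
      (a (k + 1) : ℂ) • stdVec N k + (b (k + 1) : ℂ) • stdVec N (k + 1) +
        (a (k + 2) : ℂ) • stdVec N (k + 2) := by
  ext i
  rw [toEuclideanLin_stdVec_apply _ hk]
  simp only [jacobiMatrix, stdVec, PiLp.add_apply, PiLp.smul_apply, smul_eq_mul]
  split_ifs <;> first | omega | simp_all

variable {b a} {A B : ℝ} (hb : ∀ n, |b n| ≤ B) (ha : ∀ n, |a n| ≤ A)
include hb ha

theorem sum_norm_jacobiMatrix_le {N : ℕ} (i : Fin N) :
    ∑ j, ‖jacobiMatrix b a N i j‖ ≤ B + 2 * A := by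
  have hA : 0 ≤ A := (abs_nonneg _).trans (ha 0)
  have hB : 0 ≤ B := (abs_nonneg _).trans (hb 0)
  calc ∑ j, ‖jacobiMatrix b a N i j‖
      ≤ ∑ j : Fin N, ((if (i : ℕ) = j then B else 0) + (if (i : ℕ) = j + 1 then A else 0) +
          (if (j : ℕ) = i + 1 then A else 0)) := by
        refine Finset.sum_le_sum fun j _ => ?_
        rw [jacobiMatrix]
        split_ifs <;> first | omega | simp [ha, hb]
    _ ≤ B + A + A := by
        rw [Finset.sum_add_distrib, Finset.sum_add_distrib]
        gcongr
        · exact sum_ite_const_le (fun j k hj hk => Fin.ext (hj.symm.trans hk)) hB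
        · exact sum_ite_const_le (fun j k hj hk => Fin.ext (Nat.succ_injective (hj.symm.trans hk)))
            hA
        · exact sum_ite_const_le (fun j k hj hk => Fin.ext (hj.trans hk.symm)) hA
    _ = B + 2 * A := by ring

theorem abs_le_of_hasEigenvalue_jacobiMatrix {N : ℕ} {x : ℝ}
    (hx : Module.End.HasEigenvalue (Matrix.toEuclideanLin (jacobiMatrix b a N)) (x : ℂ)) :
    |x| ≤ B + 2 * A := by
  obtain ⟨v, hv⟩ := hx.exists_hasEigenvector
  have hx' : Module.End.HasEigenvalue (Matrix.toLin' (jacobiMatrix b a N)) (x : ℂ) := by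
    refine Module.End.hasEigenvalue_of_hasEigenvector (x := v.ofLp)
      ⟨Module.End.mem_eigenspace_iff.2 ?_, (WithLp.ofLp_eq_zero 2).not.2 hv.2⟩
    exact congrArg WithLp.ofLp hv.apply_eq_smul
  obtain ⟨k, hk⟩ := exists_norm_le_sum_norm_of_hasEigenvalue hx'
  rw [Complex.norm_real, Real.norm_eq_abs] at hk
  exact hk.trans (sum_norm_jacobiMatrix_le hb ha k)

end JacobiMatrices

section Favard

/-- The monic polynomials with the three-term recurrence
`P_{n+1} = (X - b_n) P_n - a_n² P_{n-1}`, `P_0 = 1`, `P_1 = X - b_0`. -/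
def recurrencePoly (b a : ℕ → ℝ) : ℕ → ℂ[X]
  | 0 => 1
  | 1 => X - C (b 0 : ℂ)
  | n + 2 => (X - C (b (n + 1) : ℂ)) * recurrencePoly b a (n + 1) -
      C ((a (n + 1) : ℂ) ^ 2) * recurrencePoly b a n

theorem degree_C_mul_lt_degree_X_sub_C_mul {R : Type*} [Ring R] [IsDomain R] {P Q : R[X]}
    (h : P.degree < Q.degree) (b c : R) : (C c * P).degree < ((X - C b) * Q).degree :=
  calc (C c * P).degree ≤ P.degree := smul_eq_C_mul (p := P) c ▸ degree_smul_le c P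
    _ < Q.degree := h
    _ ≤ ((X - C b) * Q).degree := by
      rw [degree_mul, degree_X_sub_C]
      exact le_add_of_nonneg_left zero_le_one

theorem degree_recurrencePoly (b a : ℕ → ℝ) (n : ℕ) : (recurrencePoly b a n).degree = n := by
  induction n using Nat.twoStepInduction with
  | zero => rw [recurrencePoly, degree_one, Nat.cast_zero]
  | one => rw [recurrencePoly, degree_X_sub_C, Nat.cast_one]
  | more n ih ih' =>
    have hlt : (recurrencePoly b a n).degree < (recurrencePoly b a (n + 1)).degree := by
      rw [ih, ih']
      exact_mod_cast n.lt_succ_self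
    rw [recurrencePoly,
      degree_sub_eq_left_of_degree_lt (degree_C_mul_lt_degree_X_sub_C_mul hlt _ _), degree_mul,
      degree_X_sub_C, ih', add_comm, ← Nat.cast_add_one]

theorem monic_recurrencePoly (b a : ℕ → ℝ) (n : ℕ) : (recurrencePoly b a n).Monic := by
  induction n using Nat.twoStepInduction with
  | zero => exact monic_one
  | one => exact monic_X_sub_C _
  | more n _ ih =>
    refine ((monic_X_sub_C _).mul ih).sub_of_left (degree_C_mul_lt_degree_X_sub_C_mul ?_ _ _)
    rw [degree_recurrencePoly, degree_recurrencePoly]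
    exact_mod_cast n.lt_succ_self

/-- The recurrence polynomials, as a sequence with one member in each degree. -/
def recurrenceSequence (b a : ℕ → ℝ) : Polynomial.Sequence ℂ where
  elems' := recurrencePoly b a
  degree_eq' := degree_recurrencePoly b a

-- The recurrence is the action of the Jacobi matrix on the basis vectors.
theorem aeval_recurrencePoly (b a : ℕ → ℝ) {N k : ℕ} (hk : k < N) :
    aeval (Matrix.toEuclideanLin (jacobiMatrix b a N)) (recurrencePoly b a k) (stdVec N 0) =
      (∏ i ∈ Finset.range k, (a (i + 1) : ℂ)) • stdVec N k := by
  induction k using Nat.twoStepInduction with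
  | zero => simp [recurrencePoly]
  | one => simp [recurrencePoly, jacobiMatrix_stdVec_zero b a hk.pos]
  | more k ih ih' =>
    rw [recurrencePoly, map_sub, map_mul, map_mul, map_sub, aeval_X, aeval_C, aeval_C,
      LinearMap.sub_apply, Module.End.mul_apply, Module.End.mul_apply, ih (by omega),
      ih' (by omega), LinearMap.sub_apply, Module.algebraMap_end_apply,
      Module.algebraMap_end_apply, map_smul, jacobiMatrix_stdVec_succ b a (by omega),
      Finset.prod_range_succ _ (k + 1), Finset.prod_range_succ _ k]
    module

theorem inner_aeval_recurrencePoly (b a : ℕ → ℝ) {N j k : ℕ} (hj : j < N) (hk : k < N) :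
    inner ℂ
        (aeval (Matrix.toEuclideanLin (jacobiMatrix b a N)) (recurrencePoly b a j) (stdVec N 0))
        (aeval (Matrix.toEuclideanLin (jacobiMatrix b a N)) (recurrencePoly b a k) (stdVec N 0)) =
      if j = k then ∏ i ∈ Finset.range j, (a (i + 1) : ℂ) ^ 2 else 0 := by
  rw [aeval_recurrencePoly b a hj, aeval_recurrencePoly b a hk, inner_smul_left,
    inner_smul_right, inner_stdVec hj]
  split_ifs with hjk
  · simp only [hjk, map_prod, Complex.conj_ofReal, mul_one, ← sq, Finset.prod_pow]
  · rw [mul_zero, mul_zero]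

variable {b a : ℕ → ℝ} {A B : ℝ}

-- A weak limit of the spectral measures of the truncated Jacobi matrices.
theorem exists_orthogonality_measure (hb : ∀ n, |b n| ≤ B) (ha : ∀ n, |a n| ≤ A) :
    ∃ σ : Measure ℝ, IsProbabilityMeasure σ ∧
      (∀ᵐ x ∂σ, x ∈ Metric.closedBall (0 : ℝ) (B + 2 * A)) ∧
      ∀ j k, ∫ x : ℝ, (starRingEnd ℂ) ((recurrencePoly b a j).eval (x : ℂ)) *
          (recurrencePoly b a k).eval (x : ℂ) ∂σ =
        if j = k then ∏ i ∈ Finset.range j, (a (i + 1) : ℂ) ^ 2 else 0 := by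
  have hT (N : ℕ) := Matrix.isSymmetric_toEuclideanLin_iff.2 (isHermitian_jacobiMatrix b a (N + 1))
  let ν (N : ℕ) : Measure ℝ := spectralMeasure (hT N) (stdVec (N + 1) 0)
  have (N : ℕ) : IsProbabilityMeasure (ν N) := isProbabilityMeasure_spectralMeasure _ <| by
    rw [stdVec_of_lt N.succ_pos, PiLp.norm_single, norm_one]
  have hν (N : ℕ) : ∀ᵐ x ∂ν N, x ∈ Metric.closedBall (0 : ℝ) (B + 2 * A) :=
    ae_spectralMeasure_mem _ _ fun x hx =>
      mem_closedBall_zero_iff.2 (abs_le_of_hasEigenvalue_jacobiMatrix hb ha hx)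
  let U : Ultrafilter ℕ := Ultrafilter.of atTop
  obtain ⟨σ, hprob, hσ, hlim⟩ := exists_weakLimit (isCompact_closedBall _ _) ν hν U
  refine ⟨σ, hprob, hσ, fun j k => ?_⟩
  refine tendsto_nhds_unique (hlim _ (by fun_prop)).2 (tendsto_const_nhds.congr' ?_)
  filter_upwards [Ultrafilter.of_le atTop (eventually_ge_atTop (max j k))] with N hN
  rw [integral_polynomial_spectralMeasure, inner_aeval_recurrencePoly b a (by omega) (by omega)]

/-- **Favard's theorem** for bounded recurrence coefficients. -/
theorem exists_monicOP_eq_recurrencePoly (hb : ∀ n, |b n| ≤ B) (ha : ∀ n, |a n| ≤ A)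
    (ha0 : ∀ n, a n ≠ 0) :
    ∃ μ : Measure ℂ, IsProbabilityMeasure μ ∧ IsCompact μ.support ∧ μ.support.Infinite ∧
      μ.support ⊆ Set.range (fun x : ℝ => (x : ℂ)) ∧ ∀ n, monicOP μ n = recurrencePoly b a n := by
  obtain ⟨σ, hσprob, hσ, hint⟩ := exists_orthogonality_measure hb ha
  let μ : Measure ℂ := σ.map (↑)
  have hprob : IsProbabilityMeasure μ :=
    Measure.isProbabilityMeasure_map measurableEmbedding_ofReal.measurable.aemeasurable
  have hμ : IsCompact μ.support := isCompact_support_map_ofReal (isCompact_closedBall _ _) hσ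
  have hinner (j k : ℕ) : inner ℂ (polyLp hμ (recurrencePoly b a j))
      (polyLp hμ (recurrencePoly b a k)) =
        if j = k then ∏ i ∈ Finset.range j, (a (i + 1) : ℂ) ^ 2 else 0 := by
    rw [inner_polyLp, polyInner_map_ofReal, hint]
  have horth : Pairwise fun j k => inner ℂ (polyLp hμ (recurrenceSequence b a j))
      (polyLp hμ (recurrenceSequence b a k)) = 0 := fun j k hjk =>
    (hinner j k).trans (if_neg hjk)
  have hne (n : ℕ) : polyLp hμ (recurrenceSequence b a n) ≠ 0 := by
    refine inner_self_ne_zero (𝕜 := ℂ).1 ((hinner n n).trans_ne ?_)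
    rw [if_pos rfl, Finset.prod_ne_zero_iff]
    exact fun i _ => pow_ne_zero 2 (Complex.ofReal_ne_zero.2 (ha0 _))
  have hinf : μ.support.Infinite := support_infinite_of_polyLp_injective hμ
    (polyLp_injective_of_pairwise_orthogonal hμ _ horth hne)
  exact ⟨μ, hprob, hμ, hinf, support_map_ofReal_subset σ,
    monicOP_eq_of_pairwise_orthogonal hμ (recurrenceSequence b a) horth hinf
      (monic_recurrencePoly b a)⟩

variable {μ : Measure ℂ} [IsProbabilityMeasure μ] (hμ : IsCompact μ.support)

theorem norm_polyLp_one : ‖polyLp hμ 1‖ = 1 := by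
  have h : inner ℂ (polyLp hμ 1) (polyLp hμ 1) = 1 := by
    rw [inner_polyLp, polyInner]
    simp
  rw [norm_eq_sqrt_re_inner (𝕜 := ℂ), h]
  simp

theorem norm_le_norm_mulZ_of_monicOP_one {c : ℂ} (hc : monicOP μ 1 = X - C c) :
    ‖c‖ ≤ ‖mulZ μ hμ‖ := by
  have hmean : inner ℂ (polyLp hμ 1) (mulZ μ hμ (polyLp hμ 1)) = c := by
    have horth := inner_eq_zero_symm.1 <|
      inner_monicOP_of_degree_lt hμ (n := 1) (Q := 1) (degree_one_le.trans_lt zero_lt_one)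
    rw [hc, ← mul_one (C c), ← smul_eq_C_mul, map_sub, map_smul, inner_sub_right, inner_smul_right,
      inner_self_eq_norm_sq_to_K, norm_polyLp_one, sub_eq_zero] at horth
    rw [mulZ_polyLp, mul_one, horth]
    simp
  calc ‖c‖ ≤ ‖polyLp hμ 1‖ * ‖mulZ μ hμ (polyLp hμ 1)‖ := hmean ▸ norm_inner_le_norm _ _
    _ ≤ ‖polyLp hμ 1‖ * (‖mulZ μ hμ‖ * ‖polyLp hμ 1‖) := by
      gcongr
      exact (mulZ μ hμ).le_opNorm _
    _ = ‖mulZ μ hμ‖ := by rw [norm_polyLp_one, one_mul, mul_one]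

end Favard

section JacobiFractions

variable {H : Type*} [NormedAddCommGroup H] [InnerProductSpace ℂ H]

theorem starProjection_orthogonal_singleton_apply {e : H} (he : ‖e‖ = 1) (x : H) :
    (ℂ ∙ e)ᗮ.starProjection x = x - inner ℂ e x • e := by
  rw [Submodule.starProjection_orthogonal', sub_apply,
    Submodule.starProjection_unit_singleton ℂ he]
  rfl

/-- The compression of `A` to the orthogonal complement of `e`, extended by zero to the whole
space so that the step can be iterated without changing the space. -/
def deflation (A : H →L[ℂ] H) (e : H) : H →L[ℂ] H :=
  (ℂ ∙ e)ᗮ.starProjection ∘L A ∘L (ℂ ∙ e)ᗮ.starProjection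

theorem norm_deflation_le (A : H →L[ℂ] H) (e : H) : ‖deflation A e‖ ≤ ‖A‖ := by
  have hproj : ‖(ℂ ∙ e)ᗮ.starProjection‖ ≤ 1 := Submodule.starProjection_norm_le _
  calc ‖deflation A e‖
      ≤ ‖(ℂ ∙ e)ᗮ.starProjection‖ * (‖A‖ * ‖(ℂ ∙ e)ᗮ.starProjection‖) :=
        (ContinuousLinearMap.opNorm_comp_le _ _).trans <| by
          gcongr
          exact ContinuousLinearMap.opNorm_comp_le _ _
    _ ≤ 1 * (‖A‖ * 1) := by gcongr
    _ = ‖A‖ := by rw [one_mul, mul_one]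

theorem isSymmetric_deflation {A : H →L[ℂ] H} (hA : A.toLinearMap.IsSymmetric) (e : H) :
    (deflation A e).toLinearMap.IsSymmetric := fun x y =>
  (Submodule.inner_starProjection_left_eq_right _ _ y).trans <|
    (hA _ _).trans (Submodule.inner_starProjection_left_eq_right _ x _)

-- The Schur complement formula for the decomposition of the space into `ℂ ∙ e` and its orthogonal
-- complement.
theorem resolventFunction_mul_sub_deflation [CompleteSpace H] {A : H →L[ℂ] H}
    (hA : A.toLinearMap.IsSymmetric) {e : H} (he : ‖e‖ = 1) {z : ℂ} (hz : ‖A‖ < ‖z‖) :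
    resolventFunction A e z * (z - inner ℂ e (A e) -
      resolventFunction (deflation A e) ((ℂ ∙ e)ᗮ.starProjection (A e)) z) = 1 := by
  set v := (ℂ ∙ e)ᗮ.starProjection (A e) with hv
  set x := resolvent (deflation A e) z v with hx
  have hee : inner ℂ e e = 1 := inner_self_eq_one_of_norm_eq_one he
  have hproj (y : H) : inner ℂ e ((ℂ ∙ e)ᗮ.starProjection y) = 0 := by
    rw [starProjection_orthogonal_singleton_apply he, inner_sub_right, inner_smul_right, hee,
      mul_one, sub_self]
  have hsolve : z • x - deflation A e x = v :=
    (resolvent_apply_eq_iff ((norm_deflation_le A e).trans_lt hz)).1 hx.symm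
  have hex : inner ℂ e x = 0 := by
    have h := congrArg (inner ℂ e) hsolve
    rw [deflation, ContinuousLinearMap.comp_apply, inner_sub_right, inner_smul_right, hproj, hproj,
      sub_zero] at h
    exact (mul_eq_zero.1 h).resolve_left (norm_pos_iff.1 ((norm_nonneg A).trans_lt hz))
  have hAe : A e = v + inner ℂ e (A e) • e := by
    rw [hv, starProjection_orthogonal_singleton_apply he, sub_add_cancel]
  have heAx : inner ℂ e (A x) = inner ℂ v x := by
    have hsymm : inner ℂ e (A x) = inner ℂ (A e) x := (hA e x).symm
    rw [hsymm, hAe, inner_add_left, inner_smul_left, hex, mul_zero, add_zero]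
  have hdefl : deflation A e x = A x - inner ℂ v x • e := by
    rw [deflation, ContinuousLinearMap.comp_apply, ContinuousLinearMap.comp_apply,
      starProjection_orthogonal_singleton_apply he x, hex, zero_smul, sub_zero,
      starProjection_orthogonal_singleton_apply he, heAx]
  set s := z - inner ℂ e (A e) - inner ℂ v x with hs
  have hsum : z • (e + x) - A (e + x) = s • e := by
    rw [hdefl] at hsolve
    rw [map_add, hAe, ← hsolve, hs]
    module
  have hres := (resolvent_apply_eq_iff hz).2 hsum
  change inner ℂ e (resolvent A z e) * s = 1
  rw [mul_comm, ← inner_smul_right, ← map_smul, hres, inner_add_right, hee, hex, add_zero]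

theorem exists_norm_eq_one_smul_eq [Nontrivial H] (v : H) :
    ∃ e : H, ‖e‖ = 1 ∧ v = (‖v‖ : ℂ) • e := by
  rcases eq_or_ne v 0 with rfl | hv
  · obtain ⟨x, hx⟩ := exists_ne (0 : H)
    exact ⟨_, norm_smul_inv_norm (𝕜 := ℂ) hx, by rw [norm_zero, Complex.ofReal_zero, zero_smul]⟩
  · refine ⟨_, norm_smul_inv_norm (𝕜 := ℂ) hv, (smul_inv_smul₀ ?_ v).symm⟩
    exact Complex.ofReal_ne_zero.2 (norm_ne_zero_iff.2 hv)

theorem exists_resolventFunction_mul_sub_eq_one [CompleteSpace H] {A : H →L[ℂ] H}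
    (hA : A.toLinearMap.IsSymmetric) {e : H} (he : ‖e‖ = 1) :
    ∃ (e' : H) (β α : ℝ), ‖e'‖ = 1 ∧ |β| ≤ ‖A‖ ∧ |α| ≤ ‖A‖ ∧ ∀ z : ℂ, ‖A‖ < ‖z‖ →
      resolventFunction A e z * (z - β - α ^ 2 * resolventFunction (deflation A e) e' z) = 1 := by
  have : Nontrivial H := ⟨e, 0, norm_ne_zero_iff.1 (he ▸ one_ne_zero)⟩
  set v := (ℂ ∙ e)ᗮ.starProjection (A e) with hv
  obtain ⟨e', he', hve'⟩ := exists_norm_eq_one_smul_eq v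
  have hAe : ‖A e‖ ≤ ‖A‖ := A.unit_le_opNorm e he.le
  have hβ : ((inner ℂ e (A e)).re : ℂ) = inner ℂ e (A e) :=
    Complex.conj_eq_iff_re.1 ((inner_conj_symm _ _).trans (hA e e))
  refine ⟨e', (inner ℂ e (A e)).re, ‖v‖, he', ?_, ?_, fun z hz => ?_⟩
  · calc |(inner ℂ e (A e)).re| ≤ ‖inner ℂ e (A e)‖ := Complex.abs_re_le_norm _
      _ ≤ ‖e‖ * ‖A e‖ := norm_inner_le_norm _ _
      _ ≤ ‖A‖ := by rwa [he, one_mul]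
  · rw [abs_norm]
    exact (Submodule.norm_starProjection_apply_le _ _).trans hAe
  · have hschur := resolventFunction_mul_sub_deflation hA he hz
    rwa [← hv, hve', resolventFunction_smul, Complex.norm_real, norm_norm, ← hβ] at hschur

/-- The functions `g k` are the successive tails of the continued fraction
`1 / (z - β 0 - α 0 ² / (z - β 1 - α 1 ² / ⋯))`, with coefficients bounded by `R`, on
`{z : |z| > R}`; the relation between consecutive tails is written as a product to exclude junk
values of the division. -/
structure IsJacobiFraction (R : ℝ) (β α : ℕ → ℝ) (g : ℕ → ℂ → ℂ) : Prop where
  abs_diag_le : ∀ k, |β k| ≤ R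
  abs_offDiag_le : ∀ k, |α k| ≤ R
  norm_le : ∀ z : ℂ, R < ‖z‖ → ∀ k, ‖g k z‖ ≤ 1 / (‖z‖ - R)
  mul_sub_eq_one : ∀ z : ℂ, R < ‖z‖ → ∀ k,
    g k z * (z - β k - (α k : ℂ) ^ 2 * g (k + 1) z) = 1

theorem exists_isJacobiFraction_resolventFunction [CompleteSpace H] {A : H →L[ℂ] H}
    (hA : A.toLinearMap.IsSymmetric) {e : H} (he : ‖e‖ = 1) :
    ∃ β α g, IsJacobiFraction ‖A‖ β α g ∧ g 0 = resolventFunction A e := by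
  let S := {p : (H →L[ℂ] H) × H // p.1.toLinearMap.IsSymmetric ∧ ‖p.1‖ ≤ ‖A‖ ∧ ‖p.2‖ = 1}
  have hstep (p : S) : ∃ (q : S) (β α : ℝ), |β| ≤ ‖A‖ ∧ |α| ≤ ‖A‖ ∧ ∀ z : ℂ, ‖A‖ < ‖z‖ →
      resolventFunction p.1.1 p.1.2 z * (z - β - α ^ 2 * resolventFunction q.1.1 q.1.2 z) = 1 := by
    obtain ⟨⟨B, x⟩, hB, hBA, hx⟩ := p
    obtain ⟨x', β, α, hx', hβ, hα, hrec⟩ := exists_resolventFunction_mul_sub_eq_one hB hx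
    let q : S :=
      ⟨(deflation B x, x'), isSymmetric_deflation hB x, (norm_deflation_le B x).trans hBA, hx'⟩
    exact ⟨q, β, α, hβ.trans hBA, hα.trans hBA, fun z hz => hrec z (hBA.trans_lt hz)⟩
  choose next β α hβ hα hrec using hstep
  let s (k : ℕ) : S := next^[k] ⟨(A, e), hA, le_rfl, he⟩
  have hs (k : ℕ) : s (k + 1) = next (s k) := Function.iterate_succ_apply' _ _ _
  refine ⟨fun k => β (s k), fun k => α (s k), fun k => resolventFunction (s k).1.1 (s k).1.2,
    ⟨fun k => hβ _, fun k => hα _, fun z hz k => ?_, fun z hz k => ?_⟩, rfl⟩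
  · exact norm_resolventFunction_le (s k).2.2.1 (s k).2.2.2 hz
  · rw [hs]
    exact hrec (s k) z hz

end JacobiFractions

section StieltjesTransforms

variable {μ : Measure ℂ} [IsFiniteMeasure μ] (hμ : IsCompact μ.support) {z : ℂ}
  (hz : ‖mulZ μ hμ‖ < ‖z‖)
include hz

theorem coeFn_resolvent_mulZ_one :
    resolvent (mulZ μ hμ) z (polyLp hμ 1) =ᵐ[μ] fun w => 1 / (z - w) := by
  set u := resolvent (mulZ μ hμ) z (polyLp hμ 1) with hu
  have hsolve : z • u - mulZ μ hμ u = polyLp hμ 1 := (resolvent_apply_eq_iff hz).1 hu.symm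
  filter_upwards [Lp.coeFn_sub (z • u) (mulZ μ hμ u), Lp.coeFn_smul z u, coeFn_mulZ hμ u,
    coeFn_polyLp hμ 1] with w hsub hsmul hmul hone
  rw [hsolve, hone, eval_one, Pi.sub_apply, hsmul, hmul, Pi.smul_apply, smul_eq_mul, ← sub_mul]
    at hsub
  exact eq_one_div_of_mul_eq_one_right hsub.symm

theorem integrable_one_div_sub : Integrable (fun w => 1 / (z - w)) μ :=
  ((Lp.memLp _).integrable one_le_two).congr (coeFn_resolvent_mulZ_one hμ hz)

theorem resolventFunction_mulZ_one :
    resolventFunction (mulZ μ hμ) (polyLp hμ 1) z = ∫ w, 1 / (z - w) ∂μ := by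
  rw [resolventFunction, L2.inner_def]
  refine integral_congr_ae ?_
  filter_upwards [coeFn_resolvent_mulZ_one hμ hz, coeFn_polyLp hμ 1] with w hres hone
  rw [hres, hone, eval_one, RCLike.inner_apply, map_one, mul_one]

end StieltjesTransforms

theorem exists_isJacobiFraction_isStieltjesOutside (ν : Measure ℝ) [IsProbabilityMeasure ν]
    (hν : IsCompact ν.support) :
    ∃ R β α g, IsJacobiFraction R β α g ∧ IsStieltjesOutside ν R (g 0) := by
  let μ : Measure ℂ := ν.map (↑)
  have : IsProbabilityMeasure μ :=
    Measure.isProbabilityMeasure_map measurableEmbedding_ofReal.measurable.aemeasurable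
  have hμ : IsCompact μ.support := isCompact_support_map_ofReal hν Measure.support_mem_ae
  obtain ⟨β, α, g, hg, hg0⟩ := exists_isJacobiFraction_resolventFunction
    (isSymmetric_mulZ hμ (support_map_ofReal_subset ν)) (norm_polyLp_one hμ)
  refine ⟨_, β, α, g, hg, fun z hz => ⟨?_, ?_⟩⟩
  · exact measurableEmbedding_ofReal.integrable_map_iff.1 (integrable_one_div_sub hμ hz)
  · rw [hg0, resolventFunction_mulZ_one hμ hz, measurableEmbedding_ofReal.integral_map]

section Contraction

variable {R ε : ℝ} {β α : ℕ → ℝ} {g : ℕ → ℂ → ℂ} {z : ℂ}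

theorem norm_le_of_mul_sub_eq_one {b : ℝ} (hb : |b| ≤ R) (hz : R + 3 + 3 * R ^ 2 ≤ ‖z‖) {u x : ℂ}
    (hu : ‖u‖ ≤ 1 + R ^ 2) (hx : x * (z - b - u) = 1) : ‖x‖ ≤ 1 / (2 * (1 + R ^ 2)) := by
  have hdenom : 2 * (1 + R ^ 2) ≤ ‖z - b - u‖ := by
    have hzb := norm_sub_norm_le z (b : ℂ)
    rw [Complex.norm_real, Real.norm_eq_abs] at hzb
    linarith [norm_sub_norm_le (z - b) u]
  rw [eq_one_div_of_mul_eq_one_left hx, norm_div, norm_one]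
  exact one_div_le_one_div_of_le (by positivity) hdenom

theorem one_div_two_mul_one_add_sq_le_one (R : ℝ) : 1 / (2 * (1 + R ^ 2)) ≤ 1 := by
  rw [div_le_one (by positivity)]
  linarith [sq_nonneg R]

theorem norm_sub_le_of_mul_sub_eq_one {a b : ℝ} (hb : |b| ≤ R) (ha : |a| ≤ R)
    (hz : R + 3 + 3 * R ^ 2 ≤ ‖z‖) (hε : 0 ≤ ε) (hε1 : ε ≤ 1) {u v x y : ℂ} (hu : ‖u‖ ≤ 1)
    (hy1 : ‖y‖ ≤ 1) (hx : x * (z - b - (ε + a ^ 2) * u) = 1) (hy : y * (z - b - a ^ 2 * v) = 1) :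
    ‖x‖ ≤ 1 ∧ ‖x - y‖ ≤ (ε + ‖u - v‖) / 2 := by
  have haR : a ^ 2 ≤ R ^ 2 := sq_le_sq.2 (ha.trans (le_abs_self R))
  have hcoef : ‖((ε : ℂ) + a ^ 2) * u‖ ≤ 1 + R ^ 2 := by
    have hnorm : ‖(ε : ℂ) + a ^ 2‖ = ε + a ^ 2 := by
      rw [← Complex.ofReal_pow, ← Complex.ofReal_add, Complex.norm_of_nonneg (by positivity)]
    rw [norm_mul, hnorm]
    exact (mul_le_of_le_one_right (by positivity) hu).trans (add_le_add hε1 haR)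
  have hxle := norm_le_of_mul_sub_eq_one hb hz hcoef hx
  refine ⟨hxle.trans (one_div_two_mul_one_add_sq_le_one R), ?_⟩
  have hxy : x - y = x * y * (ε * u + a ^ 2 * (u - v)) := by
    linear_combination y * hx - x * hy
  have hlast : ‖ε * u + a ^ 2 * (u - v)‖ ≤ (1 + R ^ 2) * (ε + ‖u - v‖) := by
    calc ‖ε * u + a ^ 2 * (u - v)‖ ≤ ε * ‖u‖ + a ^ 2 * ‖u - v‖ := by
          refine (norm_add_le _ _).trans_eq ?_
          rw [norm_mul, norm_mul, norm_pow, Complex.norm_real, Complex.norm_real,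
            Real.norm_of_nonneg hε, Real.norm_eq_abs, sq_abs]
      _ ≤ (1 + R ^ 2) * ε + (1 + R ^ 2) * ‖u - v‖ := by
          gcongr ?_ + ?_ * _
          · nlinarith [mul_nonneg (sq_nonneg R) hε]
          · linarith
      _ = (1 + R ^ 2) * (ε + ‖u - v‖) := by ring
  calc ‖x - y‖ ≤ 1 / (2 * (1 + R ^ 2)) * 1 * ((1 + R ^ 2) * (ε + ‖u - v‖)) := by
        rw [hxy, norm_mul, norm_mul]
        gcongr
    _ = (ε + ‖u - v‖) / 2 := by field_simp

theorem IsJacobiFraction.norm_le_one (hg : IsJacobiFraction R β α g)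
    (hz : R + 3 + 3 * R ^ 2 ≤ ‖z‖) (k : ℕ) : ‖g k z‖ ≤ 1 := by
  have hgap : 1 ≤ ‖z‖ - R := by linarith [sq_nonneg R]
  exact (hg.norm_le z (by linarith) k).trans ((div_le_one (by linarith)).2 hgap)

-- Each step halves the distance of `x` to the tails of the fraction, up to the coupling `ε`.
theorem IsJacobiFraction.norm_sub_le_of_reversed (hg : IsJacobiFraction R β α g)
    (hz : R + 3 + 3 * R ^ 2 ≤ ‖z‖) (hε : 0 ≤ ε) (hε1 : ε ≤ 1) {m : ℕ} {x : ℕ → ℂ}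
    (hx0 : ‖x 0‖ ≤ 1)
    (hx : ∀ j < m, x (j + 1) * (z - β (m - (j + 1)) - (ε + α (m - (j + 1)) ^ 2) * x j) = 1) :
    ‖x m - g 0 z‖ ≤ 2 * (1 / 2) ^ m + ε := by
  have hzR : R < ‖z‖ := by linarith [sq_nonneg R]
  have hclose (j : ℕ) (hj : j ≤ m) :
      ‖x j‖ ≤ 1 ∧ ‖x j - g (m - j) z‖ ≤ 2 * (1 / 2) ^ j + ε := by
    induction j with
    | zero =>
      rw [Nat.sub_zero, pow_zero]
      exact ⟨hx0, by linarith [norm_sub_le (x 0) (g m z), hg.norm_le_one hz m]⟩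
    | succ j ih =>
      obtain ⟨hxj, hdist⟩ := ih (by omega)
      have hgrec := hg.mul_sub_eq_one z hzR (m - (j + 1))
      rw [show m - (j + 1) + 1 = m - j by omega] at hgrec
      obtain ⟨hle, hsub⟩ := norm_sub_le_of_mul_sub_eq_one (hg.abs_diag_le _) (hg.abs_offDiag_le _)
        hz hε hε1 hxj (hg.norm_le_one hz _) (hx j hj) hgrec
      exact ⟨hle, by rw [pow_succ]; linarith⟩
  simpa only [Nat.sub_self] using (hclose m le_rfl).2

end Contraction

section Blocks

/-- The natural numbers are cut into consecutive blocks of lengths `1, 2, 3, …`; if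
`blockIndex n = (m, k)`, then `n` lies in the `m`-th block (counted from `0`) and is followed by `k`
further members of that block. -/
def blockIndex : ℕ → ℕ × ℕ
  | 0 => (0, 0)
  | n + 1 =>
    match blockIndex n with
    | (m, 0) => (m + 1, m + 1)
    | (m, k + 1) => (m, k)

/-- The first member of the `m`-th block. -/
def blockStart : ℕ → ℕ
  | 0 => 0
  | m + 1 => blockStart m + m + 1

theorem strictMono_blockStart : StrictMono blockStart :=
  strictMono_nat_of_lt_succ fun _ => Nat.lt_succ_of_le (Nat.le_add_right _ _)

theorem blockIndex_add {n m k j : ℕ} (h : blockIndex n = (m, k)) (hj : j ≤ k) :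
    blockIndex (n + j) = (m, k - j) := by
  induction j with
  | zero => exact h
  | succ j ih =>
    have ih := ih (by omega)
    rw [show k - j = k - (j + 1) + 1 by omega] at ih
    rw [← add_assoc, blockIndex, ih]

theorem blockIndex_blockStart (m : ℕ) : blockIndex (blockStart m) = (m, m) := by
  induction m with
  | zero => rfl
  | succ m ih =>
    have hend := blockIndex_add ih le_rfl
    rw [Nat.sub_self] at hend
    simp only [blockStart, blockIndex, hend]

theorem blockIndex_blockStart_add {m j : ℕ} (hj : j ≤ m) :
    blockIndex (blockStart m + j) = (m, m - j) :=
  blockIndex_add (blockIndex_blockStart m) hj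

/-- The squares of the off-diagonal Jacobi coefficients: in each block a reversed initial segment of
the squares of `α`, shifted by `1 / (m + 1)` in the `m`-th block, which at the start of a block is
all that couples it to the preceding one. -/
def blockWeight (α : ℕ → ℝ) (n : ℕ) : ℝ :=
  1 / ((blockIndex n).1 + 1) +
    if (blockIndex n).2 = (blockIndex n).1 then 0 else α (blockIndex n).2 ^ 2

theorem blockWeight_pos (α : ℕ → ℝ) (n : ℕ) : 0 < blockWeight α n := by
  refine add_pos_of_pos_of_nonneg (by positivity) ?_
  split_ifs <;> positivity

theorem blockWeight_le {α : ℕ → ℝ} {R : ℝ} (hα : ∀ k, |α k| ≤ R) (n : ℕ) :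
    blockWeight α n ≤ 1 + R ^ 2 := by
  refine add_le_add ?_ ?_
  · exact (div_le_one (by positivity)).2 (le_add_of_nonneg_left (Nat.cast_nonneg _))
  · split_ifs
    · positivity
    · exact sq_le_sq.2 ((hα _).trans (le_abs_self R))

theorem blockWeight_blockStart (α : ℕ → ℝ) (m : ℕ) :
    blockWeight α (blockStart m) = 1 / (m + 1) := by
  rw [blockWeight, blockIndex_blockStart, if_pos rfl, add_zero]

theorem blockWeight_blockStart_add_succ (α : ℕ → ℝ) {m j : ℕ} (hj : j < m) :
    blockWeight α (blockStart m + (j + 1)) = 1 / (m + 1) + α (m - (j + 1)) ^ 2 := by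
  rw [blockWeight, blockIndex_blockStart_add hj, if_neg (by dsimp only; omega)]

variable {R C : ℝ} {β α : ℕ → ℝ} {g : ℕ → ℂ → ℂ} {z : ℂ} {s : ℕ → ℂ}
  (hg : IsJacobiFraction R β α g) (hz : R + 3 + 3 * R ^ 2 ≤ ‖z‖) (hs : ∀ n, ‖s n‖ ≤ C)
  (hrec : ∀ n, s (n + 1) *
    (z - β (blockIndex (n + 1)).2 - (blockWeight α (n + 1) : ℂ) * s n) = 1)
include hg hz hs hrec

theorem norm_blockStart_succ_le_one {m : ℕ} (hC : C ≤ m + 2) : ‖s (blockStart (m + 1))‖ ≤ 1 := by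
  have hcoupling :
      ‖(blockWeight α (blockStart (m + 1)) : ℂ) * s (blockStart m + m)‖ ≤ 1 + R ^ 2 := by
    have hle : ‖s (blockStart m + m)‖ ≤ m + 1 + 1 := (hs _).trans (by linarith)
    rw [blockWeight_blockStart, norm_mul, Complex.norm_of_nonneg (by positivity), Nat.cast_succ,
      one_div_mul_eq_div]
    exact ((div_le_one (by positivity)).2 hle).trans (le_add_of_nonneg_right (sq_nonneg R))
  exact (norm_le_of_mul_sub_eq_one (hg.abs_diag_le _) hz hcoupling (hrec (blockStart m + m))).trans
    (one_div_two_mul_one_add_sq_le_one R)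

theorem norm_blockEnd_sub_le {m : ℕ} (hC : C ≤ m + 2) :
    ‖s (blockStart (m + 1) + (m + 1)) - g 0 z‖ ≤ 2 * (1 / 2) ^ (m + 1) + 1 / ((m + 1 : ℕ) + 1) := by
  refine hg.norm_sub_le_of_reversed (x := fun j => s (blockStart (m + 1) + j)) hz (by positivity)
    ((div_le_one (by positivity)).2 (le_add_of_nonneg_left (Nat.cast_nonneg _)))
    (norm_blockStart_succ_le_one hg hz hs hrec hC) fun j hj => ?_
  have h := hrec (blockStart (m + 1) + j)
  rw [add_assoc, blockIndex_blockStart_add hj, blockWeight_blockStart_add_succ α hj,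
    Complex.ofReal_add, Complex.ofReal_pow] at h
  exact h

theorem tendsto_blockEnd : Tendsto (fun m => s (blockStart m + m)) atTop (𝓝 (g 0 z)) := by
  rw [← tendsto_add_atTop_iff_nat 1, tendsto_iff_norm_sub_tendsto_zero]
  have hpow : Tendsto (fun m : ℕ => 2 * (1 / 2 : ℝ) ^ m) atTop (𝓝 0) := by
    simpa only [mul_zero] using
      (tendsto_pow_atTop_nhds_zero_of_lt_one one_half_pos.le one_half_lt_one).const_mul (2 : ℝ)
  have hbound := hpow.add tendsto_one_div_add_atTop_nhds_zero_nat
  rw [add_zero, ← tendsto_add_atTop_iff_nat 1] at hbound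
  refine squeeze_zero' (.of_forall fun _ => norm_nonneg _) ?_ hbound
  filter_upwards [tendsto_natCast_atTop_atTop.eventually_ge_atTop C] with m hm
  exact norm_blockEnd_sub_le hg hz hs hrec (by linarith)

end Blocks

theorem tendsto_atTop_inf_principal_range_iff {X : Type*} {φ : ℕ → ℕ} (hφ : StrictMono φ)
    {f : ℕ → X} {l : Filter X} :
    Tendsto f (atTop ⊓ 𝓟 (Set.range φ)) l ↔ Tendsto (f ∘ φ) atTop l := by
  rw [← map_comap, comap_embedding_atTop (fun _ _ => hφ.le_iff_le) fun n => ⟨n, hφ.le_apply⟩,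
    tendsto_map'_iff]

theorem recurrencePoly_ratio_mul_sub_eq_one (b a : ℕ → ℝ) {z : ℂ} {n : ℕ}
    (hn : (recurrencePoly b a (n + 1)).eval z ≠ 0)
    (hn' : (recurrencePoly b a (n + 2)).eval z ≠ 0) :
    (recurrencePoly b a (n + 1)).eval z / (recurrencePoly b a (n + 2)).eval z *
      (z - b (n + 1) - (a (n + 1) : ℂ) ^ 2 *
        ((recurrencePoly b a n).eval z / (recurrencePoly b a (n + 1)).eval z)) = 1 := by
  have hrec : (recurrencePoly b a (n + 2)).eval z = (z - b (n + 1)) *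
      (recurrencePoly b a (n + 1)).eval z -
        (a (n + 1) : ℂ) ^ 2 * (recurrencePoly b a n).eval z := by
    simp only [recurrencePoly, eval_sub, eval_mul, eval_X, eval_C]
  rw [div_mul_eq_mul_div, div_eq_one_iff_eq hn', hrec]
  field_simp

-- The value `b₀ = K` makes `‖ℳ‖` at least `K`, so that the contraction estimate, which needs
-- `|z| ≥ K`, covers all `z` with `|z| > ‖ℳ‖`.
theorem exists_blockMeasure {R : ℝ} {β α : ℕ → ℝ} (hβ : ∀ k, |β k| ≤ R) (hα : ∀ k, |α k| ≤ R) :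
    ∃ (μ : Measure ℂ) (hμ : IsCompact μ.support), IsProbabilityMeasure μ ∧ μ.support.Infinite ∧
      μ.support ⊆ Set.range (fun x : ℝ => (x : ℂ)) ∧ R + 3 + 3 * R ^ 2 ≤ ‖mulZ μ hμ‖ ∧
      ∀ z, ‖mulZ μ hμ‖ < ‖z‖ → ∀ n,
        (monicOP μ (n + 1)).eval z / (monicOP μ (n + 2)).eval z *
          (z - β (blockIndex (n + 1)).2 - (blockWeight α (n + 1) : ℂ) *
            ((monicOP μ n).eval z / (monicOP μ (n + 1)).eval z)) = 1 := by
  set K : ℝ := R + 3 + 3 * R ^ 2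
  have hR : 0 ≤ R := (abs_nonneg _).trans (hβ 0)
  let b (n : ℕ) : ℝ := if n = 0 then K else β (blockIndex n).2
  let a (n : ℕ) : ℝ := √(blockWeight α n)
  have hb (n : ℕ) : |b n| ≤ K := by
    dsimp only [b]
    split_ifs
    · rw [abs_of_nonneg (by positivity)]
    · linarith [hβ (blockIndex n).2, sq_nonneg R]
  have ha (n : ℕ) : |a n| ≤ √(1 + R ^ 2) :=
    (abs_of_nonneg (Real.sqrt_nonneg _)).trans_le (Real.sqrt_le_sqrt (blockWeight_le hα n))
  obtain ⟨μ, hprob, hμ, hinf, hr, hP⟩ := exists_monicOP_eq_recurrencePoly hb ha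
    fun n => (Real.sqrt_pos.2 (blockWeight_pos α n)).ne'
  refine ⟨μ, hμ, hprob, hinf, hr, ?_, fun z hz n => ?_⟩
  · have hone : monicOP μ 1 = X - C (K : ℂ) := hP 1
    calc K ≤ ‖(K : ℂ)‖ := by rw [Complex.norm_of_nonneg (by positivity)]
      _ ≤ ‖mulZ μ hμ‖ := norm_le_norm_mulZ_of_monicOP_one hμ hone
  · have hne (n : ℕ) : (recurrencePoly b a n).eval z ≠ 0 := by
      rw [← hP]
      exact eval_monicOP_ne_zero hμ hinf hz n
    have h := recurrencePoly_ratio_mul_sub_eq_one b a (hne (n + 1)) (hne (n + 2))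
    rwa [← Complex.ofReal_pow, Real.sq_sqrt (blockWeight_pos α (n + 1)).le, ← hP, ← hP, ← hP] at h

theorem exists_isRatioLimitAlong (ν : Measure ℝ) [IsProbabilityMeasure ν]
    (hν : IsCompact ν.support) :
    ∃ (μ : Measure ℂ) (hμ : IsCompact μ.support), IsProbabilityMeasure μ ∧
      μ.support.Infinite ∧ μ.support ⊆ Set.range (fun x : ℝ => (x : ℂ)) ∧
      ∃ (N : Set ℕ) (f : ℂ → ℂ), IsStieltjesOutside ν ‖mulZ μ hμ‖ f ∧
        IsRatioLimitAlong μ hμ N f := by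
  obtain ⟨R, β, α, g, hg, hg0⟩ := exists_isJacobiFraction_isStieltjesOutside ν hν
  obtain ⟨μ, hμ, hprob, hinf, hr, hlarge, hrec⟩ :=
    exists_blockMeasure hg.abs_diag_le hg.abs_offDiag_le
  have hRμ : R ≤ ‖mulZ μ hμ‖ := by linarith [sq_nonneg R]
  have hmono : StrictMono fun m => blockStart (m + 1) :=
    strictMono_blockStart.comp (strictMono_id.add_const 1)
  refine ⟨μ, hμ, hprob, hinf, hr, Set.range fun m => blockStart (m + 1), g 0,
    fun z hz => hg0 z (hRμ.trans_lt hz), ?_, Set.infinite_range_of_injective hmono.injective,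
    fun z hz => (tendsto_atTop_inf_principal_range_iff hmono).2 ?_⟩
  · rintro _ ⟨m, rfl⟩
    exact Nat.succ_pos _
  · exact tendsto_blockEnd hg (hlarge.trans hz.le)
      (fun n => norm_monicOP_ratio_le hμ hinf hz n) (hrec z hz)

end RatioAsymptotics

end

theorem theorem3p1 :
    -- every subsequential limit is a Stieltjes transform
    (∀ (μ : Measure ℂ) [IsFiniteMeasure μ] (hμ : IsCompact μ.support),
      μ.support.Infinite → μ.support ⊆ Set.range (fun x : ℝ => (x : ℂ)) →
      ∀ (N : Set ℕ) (f : ℂ → ℂ), RatioAsymptotics.IsRatioLimitAlong μ hμ N f →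
        ∃ ν : Measure ℝ, IsProbabilityMeasure ν ∧ IsCompact ν.support ∧
          RatioAsymptotics.IsStieltjesOutside ν ‖RatioAsymptotics.mulZ μ hμ‖ f) ∧
    -- every Stieltjes transform is a subsequential limit
    (∀ (ν : Measure ℝ) [IsProbabilityMeasure ν], IsCompact ν.support →
      ∃ (μ : Measure ℂ) (hμ : IsCompact μ.support), IsProbabilityMeasure μ ∧
        μ.support.Infinite ∧ μ.support ⊆ Set.range (fun x : ℝ => (x : ℂ)) ∧
        ∃ (N : Set ℕ) (f : ℂ → ℂ),
          RatioAsymptotics.IsStieltjesOutside ν ‖RatioAsymptotics.mulZ μ hμ‖ f ∧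
          RatioAsymptotics.IsRatioLimitAlong μ hμ N f) :=
  ⟨fun _ _ hμ hinf hr _ _ hf =>
      RatioAsymptotics.exists_isStieltjesOutside_of_isRatioLimitAlong hμ hinf hr hf,
    fun ν _ hν => RatioAsymptotics.exists_isRatioLimitAlong ν hν⟩
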